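/- Let $d\ge 2$. Let $S_d$ be the symmetric group on $\{1,\dots,d\}$ and $T_d\subset S_d$ the set of transpositions; for $x,y\in T_d$ put $x\triangleright y=xyx^{-1}\in T_d$. Let $\mathrm{As}^+(T_d)$ be the monoid with generators $e_x$ ($x\in T_d$) and defining relations $e_xe_y=e_{x\triangleright y}e_x$ for all $x,y\in T_d$. The graph of a word in the letters $e_x$ has vertices $1,\dots,d$, with $i\neq j$ joined by an edge whenever the letter $e_{(i,j)}$ occurs in the word; its connected components form a partition of $\{1,\dots,d\}$, which depends only on the element of $\mathrm{As}^+(T_d)$ represented by the word. An element is called full if this partition has a single part, namely the whole set $\{1,\dots,d\}$; the full elements form a subsemigroup $\mathrm{FTS}_d$ of $\mathrm{As}^+(T_d)$. For $g\in S_d$, let $l(g)$ be the minimal number of transpositions whose product is $g$. Let $\mathbb{N}=\{0,1,2,\dots\}$ under addition, and let $S_d\times\mathbb{N}$ be the direct product. Theorem. The assignment $e_x\mapsto (x,1)$, $x\in T_d$, extends uniquely to a semigroup morphism $\mathrm{As}^+(T_d)\to S_d\times\mathbb{N}$. Its restriction $\iota_d\colon \mathrm{FTS}_d\to S_d\times\mathbb{N}$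 is injective, and its image is $$\mathrm{Im}(\iota_d)=\{\,(g,\,2(d-1)-l(g)+2k)\ :\ g\in S_d,\ k\in\mathbb{Z},\ k\ge 0\,\}.$$ -/

import Mathlib

open Equiv

/-- The defining relations `e_x e_y = e_u e_v`, where `r (x, y) = (u, v)`, of the structure
monoid of `(X, r)`. -/
inductive StructureMonoid.Rel {X : Type*} (r : X × X → X × X) :
    FreeMonoid X → FreeMonoid X → Prop
  | braid (x y : X) : StructureMonoid.Rel r
      (FreeMonoid.of x * FreeMonoid.of y)
      (FreeMonoid.of (r (x, y)).1 * FreeMonoid.of (r (x, y)).2)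

/-- The structure monoid `As⁺(X, r)`, given by its presentation. -/
abbrev StructureMonoid {X : Type*} (r : X × X → X × X) : Type _ :=
  PresentedMonoid (StructureMonoid.Rel r)

/-- The set `T_d` of transpositions in `S_d`. -/
abbrev Transp (d : ℕ) : Type := {g : Perm (Fin d) // g.IsSwap}

namespace Transp

variable {d : ℕ}

theorem isSwap_conj {x y : Perm (Fin d)} (hy : y.IsSwap) : (x * y * x⁻¹).IsSwap := by
  obtain ⟨i, j, hij, rfl⟩ := hy
  exact ⟨x i, x j, x.injective.ne hij, (Equiv.swap_apply_apply x i j).symm⟩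

/-- Conjugation `x ▷ y = x y x⁻¹` on transpositions. -/
def conj (x y : Transp d) : Transp d := ⟨x.1 * y.1 * x.1⁻¹, isSwap_conj y.2⟩

/-- The transposition solution `r (x, y) = (x ▷ y, x)`. -/
def sol (d : ℕ) (p : Transp d × Transp d) : Transp d × Transp d := (conj p.1 p.2, p.1)

end Transp

/-- The structure monoid `As⁺(T_d)` of the transposition solution. -/
abbrev AsPlusT (d : ℕ) : Type := StructureMonoid (Transp.sol d)

namespace AsPlusT

variable {d : ℕ}

/-- The generator `e_x`. -/
def e (x : Transp d) : AsPlusT d := PresentedMonoid.of (StructureMonoid.Rel (Transp.sol d)) x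

/-- The element of `As⁺(T_d)` represented by a word in the letters `e_x`. -/
def ofWord : FreeMonoid (Transp d) →* AsPlusT d :=
  PresentedMonoid.mk (StructureMonoid.Rel (Transp.sol d))

/-- The graph of a word: `i` and `j` are joined when the letter `e_(i,j)` appears in it. -/
def wordGraph (w : FreeMonoid (Transp d)) : SimpleGraph (Fin d) where
  Adj i j := i ≠ j ∧ ∃ x ∈ w.toList, x.1 = swap i j
  symm := ⟨fun i j h => ⟨h.1.symm, by simpa only [swap_comm j i] using h.2⟩⟩
  loopless := ⟨fun _ h => h.1 rfl⟩

/-- The partition of a word: the partition of the vertices into the connected components of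
its graph, as an equivalence relation. -/
def wordPartition (w : FreeMonoid (Transp d)) : Setoid (Fin d) := (wordGraph w).reachableSetoid

theorem wordPartition_le_iff (w : FreeMonoid (Transp d)) (s : Setoid (Fin d)) :
    wordPartition w ≤ s ↔ ∀ i j, (wordGraph w).Adj i j → s i j := by
  constructor
  · intro h i j hij
    exact h (show (wordGraph w).Reachable i j from hij.reachable)
  · rintro h i j ⟨p⟩
    induction p with
    | nil => exact s.refl' _
    | cons hadj _ ih => exact s.trans' (h _ _ hadj) ih

theorem wordPartition_mul (w v : FreeMonoid (Transp d)) :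
    wordPartition (w * v) = wordPartition w ⊔ wordPartition v := by
  refine eq_of_forall_ge_iff fun s => ?_
  simp only [sup_le_iff, wordPartition_le_iff, wordGraph, FreeMonoid.toList_mul,
    List.mem_append]
  constructor
  · intro h
    exact ⟨fun i j ⟨hij, x, hx, e⟩ => h i j ⟨hij, x, Or.inl hx, e⟩,
      fun i j ⟨hij, x, hx, e⟩ => h i j ⟨hij, x, Or.inr hx, e⟩⟩
  · rintro ⟨h₁, h₂⟩ i j ⟨hij, x, hx | hx, e⟩
    · exact h₁ i j ⟨hij, x, hx, e⟩
    · exact h₂ i j ⟨hij, x, hx, e⟩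

theorem wordPartition_of_le_iff (x : Transp d) (s : Setoid (Fin d)) :
    wordPartition (FreeMonoid.of x) ≤ s ↔ ∀ i, s i (x.1 i) := by
  rw [wordPartition_le_iff]
  obtain ⟨_, a, b, hab, rfl⟩ := x
  simp only [wordGraph, FreeMonoid.toList_of, List.mem_singleton, exists_eq_left]
  constructor
  · intro h i
    by_cases hi : swap a b i = i
    · rw [hi]
    · refine h i _ ⟨Ne.symm hi, ?_⟩
      rcases eq_or_ne i a with rfl | hia
      · simp
      rcases eq_or_ne i b with rfl | hib
      · rw [swap_apply_right, swap_comm]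
      · exact absurd (swap_apply_of_ne_of_ne hia hib) hi
  · rintro h i j ⟨-, hs⟩
    have := h i
    rwa [hs, swap_apply_left] at this

theorem wordPartition_braid (x y : Transp d) :
    wordPartition (FreeMonoid.of x * FreeMonoid.of y) =
      wordPartition (FreeMonoid.of (x.conj y) * FreeMonoid.of x) := by
  refine eq_of_forall_ge_iff fun s => ?_
  simp only [wordPartition_mul, sup_le_iff, wordPartition_of_le_iff, Transp.conj,
    Perm.mul_apply]
  constructor
  · rintro ⟨hx, hy⟩
    refine ⟨fun i => ?_, hx⟩
    have h := hx (x.1⁻¹ i)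
    rw [← Perm.mul_apply, mul_inv_cancel, Perm.one_apply] at h
    exact s.trans' (s.trans' (s.symm' h) (hy _)) (hx _)
  · rintro ⟨hy, hx⟩
    refine ⟨hx, fun i => ?_⟩
    have h := hy (x.1 i)
    rw [show x.1⁻¹ (x.1 i) = i from x.1.symm_apply_apply i] at h
    exact s.trans' (s.trans' (hx i) h) (s.symm' (hx _))

theorem wordPartition_eq_of_conGen (w v : FreeMonoid (Transp d))
    (h : conGen (StructureMonoid.Rel (Transp.sol d)) w v) :
    wordPartition w = wordPartition v := by
  induction (h : ConGen.Rel (StructureMonoid.Rel (Transp.sol d)) w v) with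
  | of _ _ h =>
    cases h with
    | braid x y => exact wordPartition_braid x y
  | refl _ => rfl
  | symm _ ih => exact ih.symm
  | trans _ _ ih₁ ih₂ => exact ih₁.trans ih₂
  | mul _ _ ih₁ ih₂ => rw [wordPartition_mul, wordPartition_mul, ih₁, ih₂]

/-- The partition `p(a)` of `{1, …, d}` induced by `a`: the partition of any word
representing `a`. -/
def partition (a : AsPlusT d) : Setoid (Fin d) :=
  Quotient.lift wordPartition wordPartition_eq_of_conGen a

theorem partition_ofWord (w : FreeMonoid (Transp d)) :
    partition (ofWord w) = wordPartition w := rfl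

theorem partition_mul (a b : AsPlusT d) : partition (a * b) = partition a ⊔ partition b := by
  induction a using PresentedMonoid.inductionOn with | _ w
  induction b using PresentedMonoid.inductionOn with | _ v
  exact wordPartition_mul w v

/-- `a` is full when its partition has only one part, the whole set. -/
def IsFull (a : AsPlusT d) : Prop := (partition a).classes = {Set.univ}

theorem classes_eq_singleton_univ_iff {α : Type*} (s : Setoid α) :
    s.classes = {Set.univ} ↔ Nonempty α ∧ s = ⊤ := by
  constructor
  · intro h
    have hu : Set.univ ∈ s.classes := by rw [h]; rfl
    refine ⟨?_, ?_⟩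
    · obtain ⟨y, -⟩ := hu
      exact ⟨y⟩
    · refine eq_top_iff.2 fun i j _ => ?_
      obtain ⟨y, hy⟩ := hu
      have hi : i ∈ {x | s x y} := hy ▸ Set.mem_univ i
      have hj : j ∈ {x | s x y} := hy ▸ Set.mem_univ j
      exact s.trans' hi (s.symm' hj)
  · rintro ⟨⟨a⟩, rfl⟩
    ext c
    constructor
    · rintro ⟨y, rfl⟩
      exact Set.eq_univ_of_forall fun _ => trivial
    · rintro rfl
      exact ⟨a, (Set.eq_univ_of_forall fun _ => trivial).symm⟩

end AsPlusT

/-- The full transposition semigroup `FTS_d`: the subsemigroup of full elements. -/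
def FTS (d : ℕ) : Subsemigroup (AsPlusT d) where
  carrier := {a | a.IsFull}
  mul_mem' := by
    intro a b ha hb
    have ha' := (AsPlusT.classes_eq_singleton_univ_iff _).1 ha
    exact (AsPlusT.classes_eq_singleton_univ_iff _).2
      ⟨ha'.1, by rw [AsPlusT.partition_mul, ha'.2, top_sup_eq]⟩

/-- `l(g)`: the minimal number of transpositions whose product is `g`. -/
noncomputable def transpLength {d : ℕ} (g : Perm (Fin d)) : ℕ :=
  sInf {n | ∃ w : List (Transp d), w.length = n ∧ (w.map Subtype.val).prod = g}

/-!
Full elements of `As⁺(T_d)` have a normal form that can be read off from their image in `S_d × ℕ`.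

Fix a set `s` of points and `p ∉ s`. An element supported on `s ∪ {p}` can be rewritten so that the
letters moving `p` stand on the left and are all equal: it is `e_{ip} ^ k * b` with `b` supported on
`s` (`AsPlusT.exists_eq_pow_mul`). If it connects `s ∪ {p}`, then `k ≥ 1`, and `b` connects `s`
because `p` is a leaf of the graph (`AsPlusT.connects_of_insert`).

The square of a generator is central, and multiplying `a` by `e_x ^ 2` or by `e_y ^ 2` gives the same
result when `x` and `y` are conjugate by a transposition of two points in the same part of `a`
(`AsPlusT.e_sq_mul_eq_of_partition`). Pairs of letters can therefore be passed from `e_{ip} ^ k` on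
to `b` until `k ≤ 2`, and `i` is arbitrary when `k = 2` (`AsPlusT.Connects.exists_eq_mul_or`). The
permutation `g` of the element now determines `k` and `i`: either `g p = p` and `k = 2`, or `k = 1`
and `i = g p`. It hence determines the permutation and the degree of `b`, and injectivity follows by
induction on `s` (`AsPlusT.eq_of_connects`).

For the image, gathering the letters that move `p` also shows that `l((i p) h) = l(h) + 1` when `h`
fixes `p` (`AsPlusT.transpLength_swap_mul`). Adding a point to `s` thus raises the sum of the degree
and the length of the permutation by at least `2`, and by an even number
(`AsPlusT.Connects.exists_degree_add_eq`); the normal forms without superfluous squares attain the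
minimum (`AsPlusT.exists_connects_degree_add_eq`).
-/

namespace Transp

variable {d : ℕ}

/-- The transposition of two distinct points. -/
def ofNe {i j : Fin d} (h : i ≠ j) : Transp d := ⟨swap i j, i, j, h, rfl⟩

@[simp] theorem val_ofNe {i j : Fin d} (h : i ≠ j) : (ofNe h).1 = swap i j := rfl

theorem val_inv (x : Transp d) : x.1⁻¹ = x.1 := by
  obtain ⟨_, a, b, -, rfl⟩ := x
  exact swap_inv a b

theorem val_conj (x y : Transp d) : (x.conj y).1 = x.1 * y.1 * x.1 :=
  congrArg (x.1 * y.1 * ·) x.val_inv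

theorem eq_swap_of_apply_ne (x : Transp d) {p : Fin d} (h : x.1 p ≠ p) :
    x.1 = swap p (x.1 p) := by
  revert h
  obtain ⟨_, a, b, -, rfl⟩ := x
  intro h
  rcases eq_or_ne p a with rfl | ha
  · simp
  rcases eq_or_ne p b with rfl | hb
  · simp [swap_comm]
  · exact (h (swap_apply_of_ne_of_ne ha hb)).elim

theorem conj_ofNe (x : Transp d) {i j : Fin d} (h : i ≠ j) :
    x.conj (ofNe h) = ofNe (i := x.1 i) (j := x.1 j) (x.1.injective.ne h) :=
  Subtype.ext (swap_apply_apply x.1 i j).symm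

end Transp

namespace AsPlusT

variable {d : ℕ}

/-! ### Generators, and the morphism to permutations and degrees -/

theorem e_mul_e (x y : Transp d) : e x * e y = e (x.conj y) * e x :=
  PresentedMonoid.mk_eq_mk_of_rel (StructureMonoid.Rel.braid x y)

/-- Induction on elements of `As⁺(T_d)` by multiplying with generators on the left. -/
theorem induction_left {motive : AsPlusT d → Prop} (a : AsPlusT d) (one : motive 1)
    (e_mul : ∀ x a, motive a → motive (e x * a)) : motive a := by
  have h : a ∈ Submonoid.closure (Set.range (e (d := d))) := by
    have := PresentedMonoid.closure_range_of (StructureMonoid.Rel (Transp.sol d))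
    exact this ▸ Submonoid.mem_top a
  induction h using Submonoid.closure_induction_left with
  | one => exact one
  | mul_left x hx y _ ih =>
    obtain ⟨x, rfl⟩ := hx
    exact e_mul x y ih

/-- The morphism `e_x ↦ (x, 1)`. -/
def toPermDegree : AsPlusT d →* Perm (Fin d) × Multiplicative ℕ :=
  PresentedMonoid.lift (fun x => (x.1, Multiplicative.ofAdd 1)) (by
    rintro _ _ ⟨x, y⟩
    simp [Transp.sol, Transp.conj])

/-- The product in `S_d` of the letters of any word representing `a`. -/
def perm (a : AsPlusT d) : Perm (Fin d) := (toPermDegree a).1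

/-- The number of letters of any word representing `a`. -/
def degree (a : AsPlusT d) : ℕ := Multiplicative.toAdd (toPermDegree a).2

theorem toPermDegree_e (x : Transp d) : toPermDegree (e x) = (x.1, Multiplicative.ofAdd 1) :=
  PresentedMonoid.lift_of _ _

@[simp] theorem perm_one : perm (1 : AsPlusT d) = 1 := by simp [perm]

@[simp] theorem perm_mul (a b : AsPlusT d) : perm (a * b) = perm a * perm b := by simp [perm]

@[simp] theorem perm_pow (a : AsPlusT d) (k : ℕ) : perm (a ^ k) = perm a ^ k := by simp [perm]

@[simp] theorem perm_e (x : Transp d) : perm (e x) = x.1 := by simp [perm, toPermDegree_e]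

@[simp] theorem degree_one : degree (1 : AsPlusT d) = 0 := by simp [degree]

@[simp] theorem degree_mul (a b : AsPlusT d) : degree (a * b) = degree a + degree b := by
  simp [degree]

@[simp] theorem degree_pow (a : AsPlusT d) (k : ℕ) : degree (a ^ k) = k * degree a := by
  simp [degree]

@[simp] theorem degree_e (x : Transp d) : degree (e x) = 1 := by simp [degree, toPermDegree_e]

theorem toPermDegree_eq_iff (a b : AsPlusT d) :
    toPermDegree a = toPermDegree b ↔ perm a = perm b ∧ degree a = degree b := by
  simp [Prod.ext_iff, perm, degree]

/-! ### The partition of an element -/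

theorem partition_one : partition (1 : AsPlusT d) = ⊥ := by
  refine le_bot_iff.1 ((wordPartition_le_iff 1 ⊥).2 ?_)
  rintro i j ⟨-, x, hx, -⟩
  simp at hx

theorem partition_e_le_iff (x : Transp d) (s : Setoid (Fin d)) :
    partition (e x) ≤ s ↔ ∀ i, s i (x.1 i) :=
  wordPartition_of_le_iff x s

theorem partition_e_apply (x : Transp d) (i : Fin d) : partition (e x) i (x.1 i) :=
  (partition_e_le_iff x _).1 le_rfl i

theorem partition_pow_succ (a : AsPlusT d) (k : ℕ) : partition (a ^ (k + 1)) = partition a := by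
  induction k with
  | zero => simp
  | succ k ih => rw [pow_succ, partition_mul, ih, sup_idem]

/-! ### Squares of generators -/

theorem e_mul_e_pow (x y : Transp d) (k : ℕ) : e x * e y ^ k = e (x.conj y) ^ k * e x :=
  (SemiconjBy.pow_right (show SemiconjBy (e x) (e y) (e (x.conj y)) from e_mul_e x y) k)

theorem conj_conj_self (x y : Transp d) : x.conj (x.conj y) = y := by
  obtain ⟨x, a, b, -, rfl⟩ := x
  ext1
  simp [Transp.conj, mul_assoc]

theorem commute_e_sq (x : Transp d) (a : AsPlusT d) : Commute (e x ^ 2) a := by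
  induction a using induction_left with
  | one => exact Commute.one_right _
  | e_mul y a ih =>
    refine Commute.mul_right ?_ ih
    rw [commute_iff_eq, sq, mul_assoc, e_mul_e x y, ← mul_assoc, e_mul_e x (x.conj y),
      conj_conj_self, mul_assoc]

/-- In the presence of `a`, the square of a generator may be conjugated by the transposition of two
points in the same part of `a`. For a letter of `a` this holds because the square can be moved past
that letter in two ways: as a central element, or by conjugating it. -/
theorem e_sq_mul_eq_of_partition (a : AsPlusT d) {i j : Fin d} (hij : partition a i j)
    {x y : Transp d} (hxy : y.1 = swap i j * x.1 * swap i j) : e x ^ 2 * a = e y ^ 2 * a := by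
  -- The pairs `i`, `j` whose transposition has this property form an equivalence relation, so it
  -- suffices to treat the letters of `a`.
  let r : Setoid (Fin d) :=
    { r := fun i j => ∀ x y : Transp d, y.1 = swap i j * x.1 * swap i j →
        e x ^ 2 * a = e y ^ 2 * a
      iseqv := by
        refine ⟨fun i x y h => ?_, fun {i j} h x y hxy => ?_, fun {i j k} h₁ h₂ x y hxy => ?_⟩
        · obtain rfl : y = x := Subtype.ext (by simpa [← Perm.one_def] using h)
          rfl
        · exact h x y (by rwa [swap_comm i j])
        · have key : ∀ z : Transp d, ∀ i j, ∃ w : Transp d, w.1 = swap i j * z.1 * swap i j :=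
            fun z i j => ⟨⟨swap i j * z.1 * (swap i j)⁻¹, Transp.isSwap_conj z.2⟩, by simp⟩
          rcases eq_or_ne i j with rfl | hne₁
          · exact h₂ x y hxy
          rcases eq_or_ne i k with rfl | hne₂
          · obtain rfl : y = x := Subtype.ext (by simpa [← Perm.one_def] using hxy)
            rfl
          obtain ⟨z, hz⟩ := key x j k
          obtain ⟨w, hw⟩ := key z i j
          rw [h₂ x z hz, h₁ z w hw]
          refine h₂ w y ?_
          have hs : swap j k * swap i j * swap j k = swap i k := by
            rw [swap_mul_swap_mul_swap hne₁ hne₂, swap_comm]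
          rw [hw, hz, hxy, ← hs]
          simp only [mul_assoc] }
  suffices h : ∀ b c, a = b * c → partition c ≤ r from h 1 a (one_mul a).symm hij x y hxy
  intro b c
  induction c using induction_left generalizing b with
  | one => intro _; rw [partition_one]; exact bot_le
  | e_mul z c ih =>
    intro ha
    rw [partition_mul, sup_le_iff, partition_e_le_iff]
    refine ⟨fun i x y hxy => ?_, ih (b * e z) (by rw [ha, mul_assoc])⟩
    by_cases hzi : z.1 i = i
    · obtain rfl : y = x := Subtype.ext (by simpa [hzi, ← Perm.one_def] using hxy)
      rfl
    have hz : z.1 = swap i (z.1 i) := z.eq_swap_of_apply_ne hzi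
    have hy : y = z.conj x := Subtype.ext (by rw [hxy, ← hz, Transp.val_conj])
    have hsq : e z * e x ^ 2 = e y ^ 2 * e z := by rw [hy, e_mul_e_pow]
    calc e x ^ 2 * a = b * (e z * e x ^ 2) * c := by
          rw [ha, ← mul_assoc, (commute_e_sq x b).eq, ← (commute_e_sq x (e z)).eq]
          simp only [mul_assoc]
      _ = e y ^ 2 * a := by
          rw [hsq, ← mul_assoc, ← (commute_e_sq y b).eq, ha]
          simp only [mul_assoc]

/-! ### Elements supported on a set of points -/

/-- The submonoid generated by the transpositions of points of `s`. -/
def supportedOn (s : Finset (Fin d)) : Submonoid (AsPlusT d) :=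
  Submonoid.closure (e '' {x | ∀ q ∉ s, x.1 q = q})

theorem e_mem_supportedOn {s : Finset (Fin d)} {x : Transp d} (h : ∀ q ∉ s, x.1 q = q) :
    e x ∈ supportedOn s :=
  Submonoid.subset_closure ⟨x, h, rfl⟩

theorem e_ofNe_mem_supportedOn {s : Finset (Fin d)} {i j : Fin d} (h : i ≠ j) (hi : i ∈ s)
    (hj : j ∈ s) : e (Transp.ofNe h) ∈ supportedOn s :=
  e_mem_supportedOn fun _ hq => swap_apply_of_ne_of_ne
    (fun h => hq (h ▸ hi)) (fun h => hq (h ▸ hj))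

theorem supportedOn_mono {s t : Finset (Fin d)} (h : s ⊆ t) : supportedOn s ≤ supportedOn t :=
  Submonoid.closure_mono (Set.image_mono fun _ hx q hq => hx q fun hs => hq (h hs))

theorem mem_supportedOn_univ (a : AsPlusT d) : a ∈ supportedOn Finset.univ := by
  induction a using induction_left with
  | one => exact one_mem _
  | e_mul x a ih => exact mul_mem (e_mem_supportedOn fun q hq => absurd (Finset.mem_univ q) hq) ih

theorem eq_one_of_mem_supportedOn_singleton {i : Fin d} {a : AsPlusT d}
    (ha : a ∈ supportedOn {i}) : a = 1 := by
  suffices h : {x : Transp d | ∀ q ∉ ({i} : Finset (Fin d)), x.1 q = q} = ∅ by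
    rwa [supportedOn, h, Set.image_empty, Submonoid.closure_empty, Submonoid.mem_bot] at ha
  refine Set.eq_empty_of_forall_notMem fun x hx => ?_
  obtain ⟨x, j, k, hjk, rfl⟩ := x
  have hj : j = i := by
    by_contra h
    exact hjk (by simpa using (hx j (by simpa using h)).symm)
  have hk : k = i := by
    by_contra h
    exact hjk (by simpa using hx k (by simpa using h))
  exact hjk (hj.trans hk.symm)

theorem perm_apply_of_mem_supportedOn {s : Finset (Fin d)} {a : AsPlusT d}
    (ha : a ∈ supportedOn s) {q : Fin d} (hq : q ∉ s) : perm a q = q := by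
  induction ha using Submonoid.closure_induction_left with
  | one => simp
  | mul_left x hx y _ ih =>
    obtain ⟨x, hx, rfl⟩ := hx
    rw [perm_mul, perm_e, Perm.mul_apply, ih, hx q hq]

/-- Points outside the support are isolated in the partition. -/
theorem eq_of_partition_of_mem_supportedOn {s : Finset (Fin d)} {a : AsPlusT d}
    (ha : a ∈ supportedOn s) {p q : Fin d} (hp : p ∉ s) (h : partition a p q) : q = p := by
  suffices hle : partition a ≤ Setoid.ker (· = p) from
    (iff_of_eq (hle h)).1 rfl
  clear h
  induction ha using Submonoid.closure_induction_left with
  | one => rw [partition_one]; exact bot_le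
  | mul_left x hx y _ ih =>
    obtain ⟨x, hx, rfl⟩ := hx
    rw [partition_mul, sup_le_iff, partition_e_le_iff]
    refine ⟨fun i => propext ?_, ih⟩
    constructor
    · rintro rfl
      exact hx i hp
    · intro h
      exact x.1.injective (h.trans (hx p hp).symm)

/-- Gathering the letters that move `p` on the left: since `e_{jp} e_{ip} = e_{ip} e_{ij}` for
`i ≠ j`, the number of these letters goes down until they are all equal. -/
theorem exists_eq_pow_mul {s : Finset (Fin d)} {p : Fin d} (hp : p ∉ s) {a : AsPlusT d}
    (ha : a ∈ supportedOn (insert p s)) :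
    a ∈ supportedOn s ∨ ∃ (i : Fin d) (_ : i ∈ s) (hi : i ≠ p) (k : ℕ), ∃ b ∈ supportedOn s,
      a = e (Transp.ofNe hi) ^ (k + 1) * b := by
  have hne : ∀ {i}, i ∈ s → i ≠ p := fun hi h => hp (h ▸ hi)
  have key : ∀ (k : ℕ) (i j : Fin d) (hi : i ∈ s) (hj : j ∈ s),
      ∃ (l : Fin d) (_ : l ∈ s) (hl : l ≠ p) (m : ℕ), ∃ b ∈ supportedOn s,
        e (Transp.ofNe (hne hj)) * e (Transp.ofNe (hne hi)) ^ k =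
          e (Transp.ofNe hl) ^ (m + 1) * b := by
    intro k
    induction k with
    | zero => exact fun i j hi hj => ⟨j, hj, hne hj, 0, 1, one_mem _, by simp⟩
    | succ k ih =>
      intro i j hi hj
      rcases eq_or_ne i j with rfl | hij
      · exact ⟨i, hi, hne hi, k + 1, 1, one_mem _, by rw [mul_one, ← pow_succ']⟩
      obtain ⟨l, hl, hlp, m, b, hb, h⟩ := ih j i hj hi
      refine ⟨l, hl, hlp, m, b * e (Transp.ofNe hij),
        mul_mem hb (e_ofNe_mem_supportedOn hij hi hj), ?_⟩
      have h₁ : e (Transp.ofNe (hne hj)) * e (Transp.ofNe (hne hi)) =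
          e (Transp.ofNe (hne hi)) * e (Transp.ofNe hij) := by
        rw [e_mul_e (Transp.ofNe (hne hi)), Transp.conj_ofNe]
        congr 2
        ext1
        simp [swap_apply_of_ne_of_ne hij.symm (hne hj), swap_comm j p]
      have h₂ : e (Transp.ofNe hij) * e (Transp.ofNe (hne hi)) =
          e (Transp.ofNe (hne hj)) * e (Transp.ofNe hij) := by
        rw [e_mul_e, Transp.conj_ofNe]
        congr 2
        ext1
        simp [swap_apply_of_ne_of_ne (hne hi).symm (hne hj).symm]
      have h₃ : e (Transp.ofNe hij) * e (Transp.ofNe (hne hi)) ^ k =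
          e (Transp.ofNe (hne hj)) ^ k * e (Transp.ofNe hij) :=
        SemiconjBy.pow_right h₂ k
      rw [pow_succ', ← mul_assoc, h₁, mul_assoc, h₃, ← mul_assoc, h, mul_assoc]
  induction ha using Submonoid.closure_induction_left with
  | one => exact Or.inl (one_mem _)
  | mul_left x hx y _ ih =>
    obtain ⟨x, hx, rfl⟩ := hx
    by_cases hxp : x.1 p = p
    · have hxs : ∀ q ∉ s, x.1 q = q := fun q hq => by
        rcases eq_or_ne q p with rfl | hqp
        · exact hxp
        · exact hx q (by simp [hqp, hq])
      rcases ih with ih | ⟨i, hi, hip, k, b, hb, rfl⟩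
      · exact Or.inl (mul_mem (e_mem_supportedOn hxs) ih)
      · have hxi : x.1 i ∈ s := by
          by_contra h
          exact h (by rwa [x.1.injective (hxs _ h)])
        refine Or.inr ⟨x.1 i, hxi, hne hxi, k, e x * b,
          mul_mem (e_mem_supportedOn hxs) hb, ?_⟩
        rw [← mul_assoc, e_mul_e_pow, Transp.conj_ofNe, mul_assoc]
        congr 3
        ext1
        simp [hxp]
    · have hj : x.1 p ∈ s := by
        by_contra h
        have h' : x.1 p ∉ insert p s := by simp [hxp, h]
        exact hxp (x.1.injective (hx _ h'))
      obtain ⟨j, hjs, rfl⟩ : ∃ (j : Fin d) (hj : j ∈ s), x = Transp.ofNe (hne hj) :=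
        ⟨_, hj, Subtype.ext ((x.eq_swap_of_apply_ne hxp).trans (swap_comm _ _))⟩
      rcases ih with ih | ⟨i, hi, hip, k, b, hb, rfl⟩
      · exact Or.inr ⟨j, hjs, hne hjs, 0, y, ih, by simp⟩
      · obtain ⟨l, hl, hlp, m, c, hc, h⟩ := key (k + 1) i j hi hjs
        exact Or.inr ⟨l, hl, hlp, m, c * b, mul_mem hc hb, by rw [← mul_assoc, h, mul_assoc]⟩

/-! ### Elements connecting a set of points -/

/-- All points of `s` lie in the same part of `a`. For `s` the set of all points, this says that
`a` is full. -/
def Connects (a : AsPlusT d) (s : Finset (Fin d)) : Prop :=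
  ∀ i ∈ s, ∀ j ∈ s, partition a i j

theorem isFull_iff_connects [NeZero d] (a : AsPlusT d) : IsFull a ↔ Connects a Finset.univ := by
  rw [IsFull, classes_eq_singleton_univ_iff]
  constructor
  · rintro ⟨-, h⟩ i - j -
    rw [h]
    trivial
  · intro h
    exact ⟨⟨0⟩, eq_top_iff.2 fun i j _ => h i (Finset.mem_univ i) j (Finset.mem_univ j)⟩

theorem Connects.mul_left {a : AsPlusT d} {s : Finset (Fin d)} (h : Connects a s)
    (b : AsPlusT d) : Connects (b * a) s := by
  intro i hi j hj
  rw [partition_mul]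
  exact (le_sup_right : partition a ≤ _) (h i hi j hj)

theorem connects_insert {s : Finset (Fin d)} {p i : Fin d} (hi : i ∈ s) (hip : i ≠ p)
    {a : AsPlusT d} (h : Connects a s) (k : ℕ) :
    Connects (e (Transp.ofNe hip) ^ (k + 1) * a) (insert p s) := by
  suffices hj : ∀ j ∈ insert p s, partition (e (Transp.ofNe hip) ^ (k + 1) * a) i j from
    fun j h₁ l h₂ => Setoid.trans' _ (Setoid.symm' _ (hj j h₁)) (hj l h₂)
  intro j hj
  rw [partition_mul, partition_pow_succ]
  rcases Finset.mem_insert.1 hj with rfl | hj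
  · refine (le_sup_left : partition (e (Transp.ofNe hip)) ≤ _) ?_
    simpa using partition_e_apply (Transp.ofNe hip) i
  · exact (le_sup_right : partition a ≤ _) (h i hi j hj)

/-- A point attached to `s` by copies of a single transposition is a leaf, and can be removed. -/
theorem connects_of_insert {s : Finset (Fin d)} {p i : Fin d} (hp : p ∉ s)
    (hip : i ≠ p) {a : AsPlusT d} (ha : a ∈ supportedOn s) {k : ℕ}
    (h : Connects (e (Transp.ofNe hip) ^ k * a) (insert p s)) : Connects a s := by
  -- Contract the edge joining `p` to `i`.
  let f : Fin d → Fin d := fun x => if x = p then i else x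
  have hf : ∀ x, x ≠ p → f x = x := fun x hx => if_neg hx
  have h₁ : partition (e (Transp.ofNe hip)) ≤ Setoid.comap f (partition a) := by
    rw [partition_e_le_iff]
    intro x
    rw [Setoid.comap_rel, Transp.val_ofNe]
    have : f (swap i p x) = f x := by
      rcases eq_or_ne x i with rfl | hxi
      · simp [f]
      rcases eq_or_ne x p with rfl | hxp
      · simp [f]
      · rw [swap_apply_of_ne_of_ne hxi hxp]
    rw [this]
  have h₂ : partition a ≤ Setoid.comap f (partition a) := by
    intro x y hxy
    rw [Setoid.comap_rel]
    rcases eq_or_ne x p with rfl | hx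
    · rw [eq_of_partition_of_mem_supportedOn ha hp hxy]
    rcases eq_or_ne y p with rfl | hy
    · exact absurd (eq_of_partition_of_mem_supportedOn ha hp (Setoid.symm' _ hxy)) hx
    · rwa [hf x hx, hf y hy]
  have h₃ : partition (e (Transp.ofNe hip) ^ k) ≤ Setoid.comap f (partition a) := by
    cases k with
    | zero => rw [pow_zero, partition_one]; exact bot_le
    | succ k => rwa [partition_pow_succ]
  intro x hx y hy
  have := h x (Finset.mem_insert_of_mem hx) y (Finset.mem_insert_of_mem hy)
  rw [partition_mul] at this
  have := sup_le h₃ h₂ this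
  rwa [Setoid.comap_rel, hf x fun h => hp (h ▸ hx), hf y fun h => hp (h ▸ hy)] at this

/-- Decomposition of an element connecting `s ∪ {p}` into a power of a transposition moving `p`
and an element connecting `s`. -/
theorem Connects.exists_eq_pow_mul {s : Finset (Fin d)} {p : Fin d} (hs : s.Nonempty)
    (hp : p ∉ s) {a : AsPlusT d} (ha : a ∈ supportedOn (insert p s))
    (h : Connects a (insert p s)) :
    ∃ (i : Fin d) (_ : i ∈ s) (hi : i ≠ p) (k : ℕ), ∃ b ∈ supportedOn s,
      Connects b s ∧ a = e (Transp.ofNe hi) ^ (k + 1) * b := by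
  rcases AsPlusT.exists_eq_pow_mul hp ha with ha | ⟨i, hi, hip, k, b, hb, rfl⟩
  · obtain ⟨j, hj⟩ := hs
    have := eq_of_partition_of_mem_supportedOn ha hp
      (h p (Finset.mem_insert_self p s) j (Finset.mem_insert_of_mem hj))
    exact absurd (this ▸ hj) hp
  · exact ⟨i, hi, hip, k, b, hb, connects_of_insert hp hip hb h, rfl⟩

/-- The exponent in the decomposition of an element connecting `s ∪ {p}` can be lowered to `1` or
`2`, as squares of transpositions of points of `s ∪ {p}` are central and interchangeable there; when
it is `2`, the transposition is arbitrary. -/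
theorem Connects.exists_eq_mul_or {s : Finset (Fin d)} {p : Fin d} (hs : s.Nontrivial)
    (hp : p ∉ s) {a : AsPlusT d} (ha : a ∈ supportedOn (insert p s))
    (h : Connects a (insert p s)) :
    (∃ (i : Fin d) (hi : i ≠ p), ∃ b ∈ supportedOn s,
      Connects b s ∧ a = e (Transp.ofNe hi) * b) ∨
    ∀ i ∈ s, ∀ hi : i ≠ p, ∃ b ∈ supportedOn s,
      Connects b s ∧ a = e (Transp.ofNe hi) ^ 2 * b := by
  obtain ⟨i, hi, hip, k, b, hb, hbs, rfl⟩ := h.exists_eq_pow_mul hs.nonempty hp ha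
  clear h ha
  induction k using Nat.twoStepInduction generalizing b with
  | zero => exact Or.inl ⟨i, hip, b, hb, hbs, by simp⟩
  | one =>
    refine Or.inr fun j hj hjp => ⟨b, hb, hbs, ?_⟩
    refine e_sq_mul_eq_of_partition b (hbs i hi j hj) ?_
    rw [Transp.val_ofNe, Transp.val_ofNe]
    have := swap_apply_apply (swap i j) i p
    rw [swap_apply_left] at this
    rcases eq_or_ne i j with rfl | hij
    · simp [← Perm.one_def]
    rw [swap_apply_of_ne_of_ne hip.symm hjp.symm, swap_inv] at this
    exact this
  | more k ih _ =>
    -- With `j ∈ s` other than `i`, replace two factors `e_{ip}` by `e_{ij} ^ 2`, which joins `b`.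
    obtain ⟨j, hj, hji⟩ := hs.exists_ne i
    have hc := connects_insert hi hip hbs k
    have hjp : j ≠ p := fun h => hp (h ▸ hj)
    have hsq : e (Transp.ofNe hip) ^ 2 * (e (Transp.ofNe hip) ^ (k + 1) * b) =
        e (Transp.ofNe hji.symm) ^ 2 * (e (Transp.ofNe hip) ^ (k + 1) * b) := by
      refine e_sq_mul_eq_of_partition _ (hc j (Finset.mem_insert_of_mem hj) p
        (Finset.mem_insert_self p s)) ?_
      rw [Transp.val_ofNe, Transp.val_ofNe, swap_comm j p, swap_mul_swap_mul_swap hip hji.symm,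
        swap_comm]
    have hmem : e (Transp.ofNe hji.symm) ^ 2 * b ∈ supportedOn s :=
      mul_mem (pow_mem (e_ofNe_mem_supportedOn _ hi hj) 2) hb
    have := ih _ hmem (hbs.mul_left _)
    rwa [← mul_assoc, ← ((commute_e_sq (Transp.ofNe hji.symm) (e (Transp.ofNe hip))).pow_right
      (k + 1)).eq, mul_assoc, ← hsq, ← mul_assoc, ← pow_add, show 2 + (k + 1) = k + 2 + 1 by ring]
      at this

/-! ### Injectivity -/

theorem perm_e_mul_apply_of_mem_supportedOn {s : Finset (Fin d)} {i p : Fin d} (hp : p ∉ s)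
    {a : AsPlusT d} (ha : a ∈ supportedOn s) (hi : i ≠ p) : perm (e (Transp.ofNe hi) * a) p = i := by
  rw [perm_mul, Perm.mul_apply, perm_apply_of_mem_supportedOn ha hp, perm_e, Transp.val_ofNe,
    swap_apply_right]

theorem perm_e_sq_mul (x : Transp d) (a : AsPlusT d) : perm (e x ^ 2 * a) = perm a := by
  obtain ⟨_, i, j, -, rfl⟩ := x
  rw [perm_mul, perm_pow, perm_e, sq, swap_mul_self, one_mul]

/-- An element supported on `s` and connecting it is determined by its permutation and degree. -/
theorem eq_of_connects {s : Finset (Fin d)} (hs : s.Nonempty) :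
    ∀ {a b : AsPlusT d}, a ∈ supportedOn s → b ∈ supportedOn s → Connects a s → Connects b s →
      perm a = perm b → degree a = degree b → a = b := by
  induction hs using Finset.Nonempty.cons_induction with
  | singleton i =>
    intro a b ha hb _ _ _ _
    rw [eq_one_of_mem_supportedOn_singleton ha, eq_one_of_mem_supportedOn_singleton hb]
  | cons p s hp hs ih =>
    simp only [Finset.cons_eq_insert]
    intro a b ha hb hac hbc hperm hdeg
    rcases hs.exists_eq_singleton_or_nontrivial with ⟨i, rfl⟩ | hs'
    · -- On two points there is a single generator, and the degree decides.
      obtain ⟨j, hj, hjp, k, a, ha₁, -, rfl⟩ := hac.exists_eq_pow_mul hs hp ha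
      obtain ⟨l, hl, hlp, m, b, hb₁, -, rfl⟩ := hbc.exists_eq_pow_mul hs hp hb
      obtain rfl := Finset.mem_singleton.1 hj
      obtain rfl := Finset.mem_singleton.1 hl
      obtain rfl := eq_one_of_mem_supportedOn_singleton ha₁
      obtain rfl := eq_one_of_mem_supportedOn_singleton hb₁
      simp only [mul_one, degree_pow, degree_e] at hdeg
      rw [hdeg]
    obtain ⟨l, hl⟩ := hs
    have hlp : l ≠ p := fun h => hp (h ▸ hl)
    rcases hac.exists_eq_mul_or hs' hp ha with ⟨i, hi, c, hc, hcs, rfl⟩ | h₁ <;>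
    rcases hbc.exists_eq_mul_or hs' hp hb with ⟨j, hj, c', hc', hcs', rfl⟩ | h₂
    · have hij : i = j := by
        rw [← perm_e_mul_apply_of_mem_supportedOn hp hc hi, hperm,
          perm_e_mul_apply_of_mem_supportedOn hp hc' hj]
      subst hij
      rw [perm_mul, perm_mul, mul_right_inj] at hperm
      rw [degree_mul, degree_mul, add_right_inj] at hdeg
      rw [ih hc hc' hcs hcs' hperm hdeg]
    · obtain ⟨c', hc', hcs', rfl⟩ := h₂ l hl hlp
      have := perm_e_mul_apply_of_mem_supportedOn hp hc hi
      rw [hperm, perm_e_sq_mul, perm_apply_of_mem_supportedOn hc' hp] at this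
      exact absurd this.symm hi
    · obtain ⟨c, hc, hcs, rfl⟩ := h₁ l hl hlp
      have := perm_e_mul_apply_of_mem_supportedOn hp hc' hj
      rw [← hperm, perm_e_sq_mul, perm_apply_of_mem_supportedOn hc hp] at this
      exact absurd this.symm hj
    · obtain ⟨c, hc, hcs, rfl⟩ := h₁ l hl hlp
      obtain ⟨c', hc', hcs', rfl⟩ := h₂ l hl hlp
      rw [perm_e_sq_mul, perm_e_sq_mul] at hperm
      rw [degree_mul, degree_mul, add_right_inj] at hdeg
      rw [ih hc hc' hcs hcs' hperm hdeg]

/-! ### Lengths of permutations, and the image -/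

theorem transpLength_perm_le (a : AsPlusT d) : transpLength (perm a) ≤ degree a := by
  refine Nat.sInf_le ?_
  induction a using induction_left with
  | one => exact ⟨[], by simp, by simp⟩
  | e_mul x a ih =>
    obtain ⟨w, hw, hg⟩ := ih
    exact ⟨x :: w, by simp [hw, add_comm], by
      rw [List.map_cons, List.prod_cons, hg, perm_mul, perm_e]⟩

theorem exists_degree_eq_transpLength (g : Perm (Fin d)) :
    ∃ a : AsPlusT d, perm a = g ∧ degree a = transpLength g := by
  -- The infimum defining the length is attained, as transpositions generate the symmetric group.
  have hne : {n | ∃ w : List (Transp d), w.length = n ∧ (w.map Subtype.val).prod = g}.Nonempty := by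
    induction g using Perm.swap_induction_on with
    | one => exact ⟨0, [], rfl, rfl⟩
    | swap_mul g i j hij ih =>
      obtain ⟨n, w, hw, hg⟩ := ih
      exact ⟨_, Transp.ofNe hij :: w, rfl, by
        rw [List.map_cons, List.prod_cons, hg, Transp.val_ofNe]⟩
  obtain ⟨w, hw, hg⟩ := Nat.sInf_mem hne
  refine ⟨(w.map e).prod, ?_, ?_⟩
  · rw [← hg]
    clear hw hg
    induction w with
    | nil => simp
    | cons x w ih => simp [ih]
  · rw [transpLength, ← hw]
    clear hw hg
    induction w with
    | nil => simp
    | cons x w ih => simp [ih, add_comm]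

theorem transpLength_one : transpLength (1 : Perm (Fin d)) = 0 := by
  simpa using transpLength_perm_le (1 : AsPlusT d)

theorem swap_pow_eq_ite (i j : Fin d) (k : ℕ) :
    swap i j ^ k = if Even k then 1 else swap i j := by
  split_ifs with h
  · obtain ⟨m, rfl⟩ := h
    rw [← two_mul, pow_mul, sq, swap_mul_self, one_pow]
  · obtain ⟨m, rfl⟩ := Nat.not_even_iff_odd.1 h
    rw [pow_succ, pow_mul, sq, swap_mul_self, one_pow, one_mul]

/-- For the lower bound, a shortest word for `(i p) g` is rewritten with equal letters on the left
that move `p`, followed by a word for `g`. -/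
theorem transpLength_swap_mul {g : Perm (Fin d)} {i p : Fin d} (hip : i ≠ p) (hg : g p = p) :
    transpLength (swap i p * g) = transpLength g + 1 := by
  apply le_antisymm
  · obtain ⟨a, rfl, ha⟩ := exists_degree_eq_transpLength g
    simpa [ha, add_comm] using transpLength_perm_le (e (Transp.ofNe hip) * a)
  · obtain ⟨a, hga, ha⟩ := exists_degree_eq_transpLength (swap i p * g)
    have hp : p ∉ Finset.univ.erase p := Finset.notMem_erase p _
    have hpa : perm a p = i := by simp [hga, hg]
    have hmem : a ∈ supportedOn (insert p (Finset.univ.erase p)) := by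
      rw [Finset.insert_erase (Finset.mem_univ p)]
      exact mem_supportedOn_univ a
    rcases exists_eq_pow_mul hp hmem with h | ⟨j, -, hjp, k, b, hb, rfl⟩
    · exact absurd (hpa.symm.trans (perm_apply_of_mem_supportedOn h hp)) hip
    · have hpb := perm_apply_of_mem_supportedOn hb hp
      rw [perm_mul, perm_pow, perm_e, Transp.val_ofNe, swap_pow_eq_ite] at hpa hga
      split_ifs at hpa hga
      · exact absurd (hpa.symm.trans hpb) hip
      · rw [Perm.mul_apply, hpb, swap_apply_right] at hpa
        subst hpa
        rw [mul_right_inj] at hga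
        have := transpLength_perm_le b
        rw [← ha, ← hga]
        simp
        omega

/-- The degree of an element connecting `s`, with permutation `g`, is at least
`2 (|s| - 1) - l(g)` and has the same parity. The equation is stated without subtraction. -/
theorem Connects.exists_degree_add_eq {s : Finset (Fin d)} (hs : s.Nonempty) :
    ∀ {a : AsPlusT d}, a ∈ supportedOn s → Connects a s →
      ∃ k, degree a + transpLength (perm a) + 2 = 2 * s.card + 2 * k := by
  induction hs using Finset.Nonempty.cons_induction with
  | singleton i =>
    intro a ha _
    rw [eq_one_of_mem_supportedOn_singleton ha]
    exact ⟨0, by simp [transpLength_one]⟩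
  | cons p s hp hs ih =>
    simp only [Finset.cons_eq_insert, Finset.card_insert_of_notMem hp]
    intro a ha h
    obtain ⟨i, hi, hip, k, b, hb, hbs, rfl⟩ := h.exists_eq_pow_mul hs hp ha
    obtain ⟨m, hm⟩ := ih hb hbs
    have hpb := perm_apply_of_mem_supportedOn hb hp
    rw [perm_mul, perm_pow, perm_e, Transp.val_ofNe, swap_pow_eq_ite]
    simp only [degree_mul, degree_pow, degree_e, mul_one]
    split_ifs with hk
    · rw [one_mul]
      obtain ⟨n, hn⟩ := hk
      exact ⟨m + n - 1, by omega⟩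
    · rw [transpLength_swap_mul hip hpb]
      obtain ⟨n, hn⟩ := Nat.not_even_iff_odd.1 hk
      exact ⟨m + n, by omega⟩

/-- The smallest degree of elements connecting `s` with a given permutation is attained. -/
theorem exists_connects_degree_add_eq {s : Finset (Fin d)} (hs : s.Nonempty) :
    ∀ g : Perm (Fin d), (∀ q ∉ s, g q = q) → ∃ a ∈ supportedOn s, Connects a s ∧ perm a = g ∧
      degree a + transpLength g + 2 = 2 * s.card := by
  induction hs using Finset.Nonempty.cons_induction with
  | singleton i =>
    intro g hg
    obtain rfl : g = 1 := by
      have hne : ∀ q, q ≠ i → g q = q := fun q hq => hg q (by simpa using hq)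
      ext1 q
      by_cases hq : q = i
      · subst hq
        by_contra h
        exact h (g.injective (hne _ h))
      · exact hne q hq
    refine ⟨1, one_mem _, fun j hj l hl => ?_, perm_one, by simp [transpLength_one]⟩
    rw [Finset.mem_singleton.1 hj, Finset.mem_singleton.1 hl]
  | cons p s hp hs ih =>
    simp only [Finset.cons_eq_insert, Finset.card_insert_of_notMem hp]
    intro g hg
    have hmem : ∀ {i} (_ : i ∈ s) (hip : i ≠ p) {a : AsPlusT d} (_ : a ∈ supportedOn s) (k : ℕ),
        e (Transp.ofNe hip) ^ k * a ∈ supportedOn (insert p s) := fun hi hip a ha k =>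
      mul_mem (pow_mem (e_ofNe_mem_supportedOn hip (Finset.mem_insert_of_mem hi)
        (Finset.mem_insert_self p s)) k) (supportedOn_mono (Finset.subset_insert p s) ha)
    by_cases hgp : g p = p
    · obtain ⟨a, ha, hac, rfl, hdeg⟩ := ih g fun q hq => by
        rcases eq_or_ne q p with rfl | hqp
        · exact hgp
        · exact hg q (by simp [hqp, hq])
      obtain ⟨i, hi⟩ := hs
      have hip : i ≠ p := fun h => hp (h ▸ hi)
      refine ⟨_, hmem hi hip ha 2, connects_insert hi hip hac 1, by simp [sq], ?_⟩
      simp only [degree_mul, degree_pow, degree_e]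
      omega
    · have hi : g p ∈ s := by
        by_contra h
        have h' : g p ∉ insert p s := by simp [hgp, h]
        exact hgp (g.injective (hg _ h'))
      obtain ⟨a, ha, hac, hga, hdeg⟩ := ih (swap (g p) p * g) fun q hq => by
        rcases eq_or_ne q p with rfl | hqp
        · simp
        · have hgq : g q = q := hg q (by simp [hqp, hq])
          rw [Perm.mul_apply, hgq]
          exact swap_apply_of_ne_of_ne (fun h => hq (h ▸ hi)) hqp
      have hgp' : (swap (g p) p * g) p = p := by simp
      have hlen := transpLength_swap_mul hgp hgp'
      rw [swap_mul_self_mul] at hlen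
      refine ⟨_, hmem hi hgp ha 1, connects_insert hi hgp hac 0, ?_, ?_⟩
      · simp [hga, swap_mul_self_mul]
      · simp only [degree_mul, degree_pow, degree_e]
        omega

end AsPlusT

/-- `S_d × ℕ`, with `ℕ` under addition, is written `Perm (Fin d) × Multiplicative ℕ`. -/
theorem mainTheorem4 (d : ℕ) (hd : 2 ≤ d) :
    ∃ φ : AsPlusT d →ₙ* Equiv.Perm (Fin d) × Multiplicative ℕ,
      (∀ x : Transp d, φ (AsPlusT.e x) = (x.1, Multiplicative.ofAdd 1)) ∧
      (∀ ψ : AsPlusT d →ₙ* Equiv.Perm (Fin d) × Multiplicative ℕ,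
        (∀ x : Transp d, ψ (AsPlusT.e x) = (x.1, Multiplicative.ofAdd 1)) → ψ = φ) ∧
      Function.Injective (φ.domRestrict (FTS d)) ∧
      Set.range (φ.domRestrict (FTS d)) =
        {p | ∃ k : ℕ, ((Multiplicative.toAdd p.2 : ℕ) : ℤ) =
          2 * ((d : ℤ) - 1) - (transpLength p.1 : ℤ) + 2 * (k : ℤ)} := by
  have : NeZero d := ⟨by omega⟩
  have hne : (⟨0, by omega⟩ : Fin d) ≠ ⟨1, by omega⟩ := by simp
  refine ⟨(AsPlusT.toPermDegree : AsPlusT d →* _), AsPlusT.toPermDegree_e, fun ψ hψ => ?_, ?_, ?_⟩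
  · -- A semigroup morphism preserves `1`, as the target is cancellative.
    have hone : ψ 1 = 1 := by
      have h := map_mul ψ 1 (AsPlusT.e (Transp.ofNe hne))
      rw [one_mul] at h
      exact right_eq_mul.1 h
    ext1 a
    induction a using AsPlusT.induction_left with
    | one => exact hone.trans (map_one AsPlusT.toPermDegree).symm
    | e_mul x a ih =>
      rw [map_mul, map_mul, ih, hψ]
      exact congrArg (· * _) (AsPlusT.toPermDegree_e x).symm
  · rintro ⟨a, ha⟩ ⟨b, hb⟩ hab
    obtain ⟨hperm, hdeg⟩ := (AsPlusT.toPermDegree_eq_iff a b).1 hab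
    exact Subtype.ext (AsPlusT.eq_of_connects Finset.univ_nonempty (AsPlusT.mem_supportedOn_univ a)
      (AsPlusT.mem_supportedOn_univ b) ((AsPlusT.isFull_iff_connects a).1 ha)
      ((AsPlusT.isFull_iff_connects b).1 hb) hperm hdeg)
  · ext ⟨g, n⟩
    constructor
    · rintro ⟨⟨a, ha⟩, h⟩
      obtain ⟨rfl, rfl⟩ := Prod.ext_iff.1 h
      obtain ⟨k, hk⟩ := AsPlusT.Connects.exists_degree_add_eq Finset.univ_nonempty
        (AsPlusT.mem_supportedOn_univ a) ((AsPlusT.isFull_iff_connects a).1 ha)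
      rw [Finset.card_fin] at hk
      refine ⟨k, ?_⟩
      change (AsPlusT.degree a : ℤ) = 2 * ((d : ℤ) - 1) - (transpLength (AsPlusT.perm a) : ℤ) + _
      omega
    · rintro ⟨k, hk⟩
      obtain ⟨a, -, hac, rfl, hdeg⟩ := AsPlusT.exists_connects_degree_add_eq
        (s := Finset.univ) Finset.univ_nonempty g fun q hq => absurd (Finset.mem_univ q) hq
      rw [Finset.card_fin] at hdeg
      -- The surplus `2 k` is supplied by squares, which do not change the permutation.
      refine ⟨⟨AsPlusT.e (Transp.ofNe hne) ^ (2 * k) * a,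
        (AsPlusT.isFull_iff_connects _).2 (hac.mul_left _)⟩, Prod.ext ?_ ?_⟩
      · change AsPlusT.perm (AsPlusT.e (Transp.ofNe hne) ^ (2 * k) * a) = _
        simp [AsPlusT.swap_pow_eq_ite]
      · change AsPlusT.degree (AsPlusT.e (Transp.ofNe hne) ^ (2 * k) * a) = Multiplicative.toAdd n
        simp only [AsPlusT.degree_mul, AsPlusT.degree_pow, AsPlusT.degree_e]
        dsimp only at hk
        omega
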